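/- **Conventions.** $\mathbb N=\{1,2,\dots\}$, and $r'=\frac{r}{r-1}$ is the Hölder conjugate of $r\in(1,\infty)$. A Rademacher family is a sequence $(r_j)_{j\in\mathbb N}$ of independent random variables with values in $\{-1,1\}$, each value having probability $\frac12$. A real normed space $F$ is of (Rademacher) type $p\in[1,2]$ if there is $\tau\in(0,\infty)$ such that $\bigl\|\sum_{j=1}^n r_jx_j\bigr\|_{L^p(\widetilde\Omega;F)}\le\tau\bigl(\sum_{j=1}^n\|x_j\|_F^p\bigr)^{1/p}$ for every Rademacher family $(r_j)_{j\in\mathbb N}$ on a probability space $\widetilde\Omega$, all $n\in\mathbb N$ and all $x_1,\dots,x_n\in F$; the infimum of these $\tau$ is the type $p$ constant $\tau_p(F)$. **Theorem.** Let $q\in(1,\infty)$, $\bar q:=\min\{q,2\}$, $\alpha,\gamma,C_\alpha,C_{\mathsf{stab}},C_\gamma,c_1,c_2\in(0,\infty)$, $a_0,a_1\in[0,\infty)$, $C_\tau\in[1,\infty)$ and $A\in(1,\infty)$. Then there is a constant $C\in(0,\infty)$, depending only on these numbers, such that the following holds. Let $p\in[1,2]$ with $p\le q$, let $E$ be a real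 Banach space of Rademacher type $p$, let $(\Omega,\mathcal A,\mathbb P)$ be a probability space, and let $X\in L^1(\Omega;E)$. Let $(E_\ell)_{\ell\in\mathbb N}$ be finite-dimensional subspaces of $E$ with dimensions $N_\ell:=\dim(E_\ell)$ such that $c_1A^\ell\le N_\ell\le c_2A^\ell$ for all $\ell\in\mathbb N$ and $$\sup_{\ell\in\mathbb N}\ \sup_{r\in[p,2]\cap(1,2]} N_\ell^{-(a_0-a_1r')}\,[\tau_r(E_\ell)]^{r'}\le C_\tau .$$ For every $\ell\in\mathbb N$ let $(X_{\ell,j})_{j\in\mathbb N}$ be a sequence of independent copies of a random variable $X_\ell\in L^q(\Omega;E_\ell)$, where $$\sup_{\ell\in\mathbb N}N_\ell^\alpha\,\bigl\|\mathbb E[X]-\mathbb E[X_\ell]\bigr\|_E\le C_\alpha,\qquad \sup_{\ell\in\mathbb N}\bigl\|X_\ell-\mathbb E[X_\ell]\bigr\|_{L^q(\Omega;E)}\le C_{\mathsf{stab}}.$$ Let $\mathcal C_\ell\ge 0$ be the cost of generating one sample of $X_\ell$, and assume $\mathcal C_\ell\le C_\gamma N_\ell^\gamma$ for all $\ell\in\mathbb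 N$. Then, for every $\epsilon\in(0,\frac12]$, there are $L,M_L\in\mathbb N$ such that the single-level Monte Carlo estimator satisfies $$\biggl\|\mathbb E[X]-\frac1{M_L}\sum_{j=1}^{M_L}X_{L,j}\biggr\|_{L^q(\Omega;E)}<\epsilon,$$ and its computational cost $\mathcal C^{\mathsf{SL}}_q(X):=M_L\,\mathcal C_L$ satisfies $$\mathcal C^{\mathsf{SL}}_q(X)\le C\cdot\begin{cases}\epsilon^{-\frac\gamma\alpha}+\epsilon^{-\bar q'-\frac{\gamma+a_0-a_1\bar q'}{\alpha}}&\text{if }\alpha\ge a_1,\\[2pt]\epsilon^{-\frac\gamma\alpha}+\epsilon^{-p'-\frac{\gamma+a_0-a_1p'}{\alpha}}&\text{if }\alpha<a_1\text{ and }p\in(1,2].\end{cases}$$ In particular, for $\alpha\ge a_1$ the bound does not depend on the type $p$. -/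

import Mathlib

open MeasureTheory ProbabilityTheory

universe u v

/-- `(r j)` is a Rademacher family: independent random variables with values in `{-1, 1}`, each
value being taken with probability `1/2`. -/
structure IsRademacherFamily {S : Type*} [MeasurableSpace S] (Q : Measure S)
    (r : ℕ → S → ℝ) : Prop where
  measurable : ∀ j, Measurable (r j)
  values : ∀ j s, r j s = 1 ∨ r j s = -1
  indep : iIndepFun r Q
  prob_one : ∀ j, Q {s | r j s = 1} = 1 / 2
  prob_neg_one : ∀ j, Q {s | r j s = -1} = 1 / 2

/-- The type `p` inequality with constant `τ`: for every Rademacher family on a probability space,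
every `n` and all vectors `x 0, …, x (n - 1)`,
`‖∑ r j • x j‖_{L^p} ≤ τ * (∑ ‖x j‖ ^ p) ^ (1 / p)`.
The left-hand side depends on the Rademacher family only through its law, so that probability
spaces in `Type` suffice. -/
def HasTypeConstant (E : Type*) [NormedAddCommGroup E] [NormedSpace ℝ E] (p τ : ℝ) : Prop :=
  ∀ (S : Type) [MeasurableSpace S] (Q : Measure S) [IsProbabilityMeasure Q] (r : ℕ → S → ℝ),
    IsRademacherFamily Q r → ∀ (n : ℕ) (x : ℕ → E),
      eLpNorm (fun s => ∑ j ∈ Finset.range n, r j s • x j) (ENNReal.ofReal p) Q ≤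
        ENNReal.ofReal (τ * (∑ j ∈ Finset.range n, ‖x j‖ ^ p) ^ (1 / p))

/-- `E` is of Rademacher type `p`. -/
def IsOfRademacherType (E : Type*) [NormedAddCommGroup E] [NormedSpace ℝ E] (p : ℝ) : Prop :=
  ∃ τ : ℝ, 0 < τ ∧ HasTypeConstant E p τ

/-- The type `p` constant `τ_p(E)`, as an extended nonnegative number; it is `∞` exactly when `E`
is not of type `p`. -/
noncomputable def typeConstant (E : Type*) [NormedAddCommGroup E] [NormedSpace ℝ E] (p : ℝ) :
    ENNReal :=
  sInf (ENNReal.ofReal '' {τ : ℝ | 0 < τ ∧ HasTypeConstant E p τ})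

/-- Growth of the type constants of the finite-dimensional subspaces `V ℓ`:
`(dim V ℓ) ^ (-(a₀ - a₁ r')) * τ_r(V ℓ) ^ r' ≤ Cτ` for all `ℓ` and all `r ∈ [p, 2] ∩ (1, 2]`,
where `r' = r / (r - 1)` is the Hölder conjugate of `r`. -/
def TypeConstantGrowth {E : Type*} [NormedAddCommGroup E] [NormedSpace ℝ E]
    (V : ℕ+ → Submodule ℝ E) (p a₀ a₁ Cτ : ℝ) : Prop :=
  ∀ ℓ : ℕ+, ∀ r ∈ Set.Icc p 2 ∩ Set.Ioc 1 2,
    ENNReal.ofReal ((Module.finrank ℝ (V ℓ) : ℝ) ^ (-(a₀ - a₁ * r.conjExponent))) *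
      typeConstant (V ℓ) r ^ r.conjExponent ≤ ENNReal.ofReal Cτ

/-- The `L^q(Ω; E)`-error of the single-level Monte Carlo estimator for `𝔼[X]` that averages the
first `M` members of the sequence `Y` of samples. -/
noncomputable def slmcError {Ω E : Type*} [MeasurableSpace Ω] [NormedAddCommGroup E]
    [NormedSpace ℝ E] (P : Measure Ω) (q : ℝ) (X : Ω → E) (Y : ℕ → Ω → E) (M : ℕ) : ENNReal :=
  eLpNorm (fun ω => (∫ ω', X ω' ∂P) - (1 / (M : ℝ)) • ∑ j ∈ Finset.range M, Y j ω)
    (ENNReal.ofReal q) P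

/-- The cost of the single-level Monte Carlo estimator on level `L` with `M` samples, where one
sample on level `ℓ` costs `cost ℓ`. -/
def slmcCost (cost : ℕ+ → ℝ) (L : ℕ+) (M : ℕ) : ℝ := M * cost L

/-! The error splits into a bias and a centred average in the finite-dimensional space `V L`. The
bias is at most `ε / 4` once the dimension `N` is of order `ε ^ (-(1 / α))`. For any admissible type
`r`, with conjugate `s`, the average is at most `K * τ * M ^ (-(1 / s)) * Cstab`, so `M` of order `ε
^ (-s) * N ^ (a₀ - a₁ * s)` samples suffice. In the resulting cost, `s` enters the power of `ε`
through `ε ^ ((a₁ / α - 1) * s)`: for `a₁ ≤ α` the smallest `s`, i.e. `r = min q 2`, is best, and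
for `α < a₁` the largest, i.e. `r = p`.

The constant must not depend on `p`, although `p.conjExponent` blows up as `p` tends to `1`. This
needs two things. First, `K` depends on `q` only: Rademacher sums concentrate around their mean norm
(`integral_exp_norm_le`), which upgrades the `L^r` type inequality to `L^q` uniformly in `r`, and
symmetrization transfers it to independent variables (`exists_eLpNorm_sum_le_of_hasTypeConstant`).
Second, the level is taken fine enough that the base of the factor raised to the power `s` is at
most `1`. -/

/-! ### Rademacher families and concentration of their sums -/

/-- There is a Rademacher family on some probability space in `Type`. -/
theorem exists_isRademacherFamily :
    ∃ (S : Type) (_ : MeasurableSpace S) (Q : Measure S) (_ : IsProbabilityMeasure Q)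
      (r : ℕ → S → ℝ), IsRademacherFamily Q r := by
  let μ : Measure Bool := (PMF.uniformOfFintype Bool).toMeasure
  have hμ : IsProbabilityMeasure μ := inferInstance
  let f : Bool → ℝ := fun b => if b then 1 else -1
  have hf : Measurable f := measurable_from_top
  have key : ∀ (j : ℕ) (b : Bool),
      Measure.infinitePi (fun _ : ℕ => μ) ((fun s : ℕ → Bool => s j) ⁻¹' {b}) = 1 / 2 := by
    intro j b
    rw [← Measure.map_apply (measurable_pi_apply j) (measurableSet_singleton b),
      Measure.infinitePi_map_eval (fun _ : ℕ => μ) j,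
      PMF.toMeasure_apply_singleton _ _ (measurableSet_singleton b)]
    simp
  refine ⟨ℕ → Bool, inferInstance, Measure.infinitePi fun _ => μ, inferInstance,
    fun j s => f (s j), ?_, ?_, ?_, ?_, ?_⟩
  · exact fun j => hf.comp (measurable_pi_apply j)
  · intro j s
    cases h : s j <;> simp [f]
  · exact iIndepFun_infinitePi (fun _ => hf)
  · intro j
    rw [← key j true]
    congr 1
    ext s
    cases h : s j <;> simp [f, h]
    norm_num
  · intro j
    rw [← key j false]
    congr 1
    ext s
    cases h : s j <;> simp [f, h]
    norm_num

namespace IsRademacherFamily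

variable {S : Type*} [MeasurableSpace S] {Q : Measure S} {r : ℕ → S → ℝ}

theorem abs_eq_one (hr : IsRademacherFamily Q r) (j : ℕ) (s : S) : |r j s| = 1 := by
  rcases hr.values j s with h | h <;> simp [h]

variable [IsProbabilityMeasure Q] {V : Type*} [NormedAddCommGroup V] [NormedSpace ℝ V]

theorem integral_eq_zero (hr : IsRademacherFamily Q r) (j : ℕ) : ∫ s, r j s ∂Q = 0 := by
  have hm : MeasurableSet {s | r j s = 1} := hr.measurable j (measurableSet_singleton 1)
  have h : ∀ s, r j s = 2 * Set.indicator {s | r j s = 1} (fun _ => (1 : ℝ)) s - 1 := by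
    intro s
    rcases hr.values j s with h | h
    · rw [Set.indicator_of_mem (by simpa using h), h]; norm_num
    · rw [Set.indicator_of_notMem (by simp [h]; norm_num), h]; norm_num
  rw [integral_congr_ae (Filter.Eventually.of_forall h), integral_sub, integral_const_mul,
    integral_indicator hm]
  · simp [Measure.real, hr.prob_one j]
  · exact ((integrable_const (1 : ℝ)).indicator hm).const_mul 2
  · exact integrable_const _

/-- The integrand is a continuous function of the sign vector, which stays in a compact cube.
Measurability is taken from the finite product of copies of `ℝ`, so `V` needs no Borel structure. -/
theorem integrable_comp_sum (hr : IsRademacherFamily Q r) {F : V → ℝ} (hF : Continuous F)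
    (n : ℕ) (x : ℕ → V) (y : V) :
    Integrable (fun s => F (y + ∑ j ∈ Finset.range n, r j s • x j)) Q := by
  let G : (Finset.range n → ℝ) → ℝ := fun z => F (y + ∑ j, z j • x j)
  have hG : Continuous G := by fun_prop
  have hGS : (fun s => F (y + ∑ j ∈ Finset.range n, r j s • x j)) =
      fun s => G (fun j => r j s) := by
    funext s
    simp only [G]
    rw [← Finset.sum_coe_sort (Finset.range n)]
  obtain ⟨C, hC⟩ := (isCompact_closedBall (0 : Finset.range n → ℝ) 1).exists_bound_of_continuousOn
    hG.continuousOn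
  rw [hGS]
  refine Integrable.of_bound (hG.measurable.comp
    (measurable_pi_lambda _ fun j => hr.measurable j)).aestronglyMeasurable C
    (Filter.Eventually.of_forall fun s => hC _ ?_)
  rw [mem_closedBall_zero_iff, pi_norm_le_iff_of_nonneg zero_le_one]
  intro j
  rw [Real.norm_eq_abs, hr.abs_eq_one]

/-- Conditioning on the last sign: the part odd in `r n` integrates to zero, because `r n` is
centred and independent of the other signs. -/
theorem integral_comp_sum_succ (hr : IsRademacherFamily Q r) {F : V → ℝ} (hF : Continuous F)
    (n : ℕ) (x : ℕ → V) (y : V) :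
    ∫ s, F (y + ∑ j ∈ Finset.range (n + 1), r j s • x j) ∂Q =
      (∫ s, F (y + x n + ∑ j ∈ Finset.range n, r j s • x j) ∂Q +
        ∫ s, F (y - x n + ∑ j ∈ Finset.range n, r j s • x j) ∂Q) / 2 := by
  have hind : ∀ w : V,
      ∫ s, r n s * F (w + ∑ j ∈ Finset.range n, r j s • x j) ∂Q = 0 := by
    intro w
    have h1 := hr.indep.indepFun_finset {n} (Finset.range n) (by simp) hr.measurable
    have hφ : Measurable fun z : (({n} : Finset ℕ) → ℝ) => z ⟨n, by simp⟩ := measurable_pi_apply _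
    have hψ : Measurable fun z : (Finset.range n → ℝ) => F (w + ∑ j, z j • x j) :=
      Continuous.measurable (by fun_prop)
    have h3 := (h1.comp hφ hψ).integral_fun_mul_eq_mul_integral
      (hr.measurable n).aestronglyMeasurable
      (hψ.comp (measurable_pi_lambda _ fun j : Finset.range n =>
        hr.measurable j)).aestronglyMeasurable
    simp only [Function.comp_apply] at h3
    rw [hr.integral_eq_zero, zero_mul] at h3
    rw [← h3]
    refine integral_congr_ae (Filter.Eventually.of_forall fun s => ?_)
    simp only
    rw [← Finset.sum_coe_sort (Finset.range n)]
  have hI := fun w => hr.integrable_comp_sum (V := V) hF n x w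
  have hrI : ∀ w, Integrable
      (fun s => r n s * F (w + ∑ j ∈ Finset.range n, r j s • x j)) Q := fun w =>
    (hI w).bdd_mul (c := 1) (hr.measurable n).aestronglyMeasurable
      (Filter.Eventually.of_forall fun s => by rw [Real.norm_eq_abs, hr.abs_eq_one])
  have hpt : ∀ s, F (y + ∑ j ∈ Finset.range (n + 1), r j s • x j) =
      ((F (y + x n + ∑ j ∈ Finset.range n, r j s • x j) +
        F (y - x n + ∑ j ∈ Finset.range n, r j s • x j)) +
      (r n s * F (y + x n + ∑ j ∈ Finset.range n, r j s • x j) -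
        r n s * F (y - x n + ∑ j ∈ Finset.range n, r j s • x j))) / 2 := by
    intro s
    rw [Finset.sum_range_succ]
    rcases hr.values n s with h | h
    · rw [h, one_smul, show y + (∑ j ∈ Finset.range n, r j s • x j + x n) =
        y + x n + ∑ j ∈ Finset.range n, r j s • x j by abel]
      ring
    · rw [h, neg_one_smul, show y + (∑ j ∈ Finset.range n, r j s • x j + -x n) =
        y - x n + ∑ j ∈ Finset.range n, r j s • x j by abel]
      ring
  rw [integral_congr_ae (Filter.Eventually.of_forall hpt), integral_div, integral_add,
    integral_add, integral_sub, hind, hind, sub_zero, add_zero]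
  exacts [hrI _, hrI _, hI _, hI _, (hI _).add (hI _), (hrI _).sub (hrI _)]

/-- Bounded differences inequality for the norm of a Rademacher sum. -/
theorem integral_exp_norm_le (hr : IsRademacherFamily Q r) (c : ℝ) (x : ℕ → V) (n : ℕ) (y : V) :
    ∫ s, Real.exp (c * ‖y + ∑ j ∈ Finset.range n, r j s • x j‖) ∂Q ≤
      Real.exp (c * ∫ s, ‖y + ∑ j ∈ Finset.range n, r j s • x j‖ ∂Q +
        c ^ 2 / 2 * ∑ j ∈ Finset.range n, ‖x j‖ ^ 2) := by
  -- Conditioning on the last sign shifts the starting point to `y ± x n`, hence the general `y`.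
  induction n generalizing y with
  | zero => simp
  | succ n ih =>
    rw [hr.integral_comp_sum_succ (F := fun v => Real.exp (c * ‖v‖)) (by fun_prop),
      hr.integral_comp_sum_succ (F := fun v => ‖v‖) (by fun_prop), Finset.sum_range_succ]
    have hi := fun w : V => hr.integrable_comp_sum (F := fun v => ‖v‖) (by fun_prop) n x w
    have h1 := ih (y + x n)
    have h2 := ih (y - x n)
    -- The two conditional means differ by at most `2 * ‖x n‖`, so averaging their exponentials
    -- costs a factor `cosh` of at most `c * ‖x n‖`.
    have hab : |∫ s, ‖y + x n + ∑ j ∈ Finset.range n, r j s • x j‖ ∂Q -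
        ∫ s, ‖y - x n + ∑ j ∈ Finset.range n, r j s • x j‖ ∂Q| ≤ 2 * ‖x n‖ := by
      rw [← integral_sub (hi _) (hi _), ← Real.norm_eq_abs]
      refine (norm_integral_le_of_norm_le_const (C := 2 * ‖x n‖)
        (Filter.Eventually.of_forall fun s => ?_)).trans (by simp)
      rw [Real.norm_eq_abs]
      refine (abs_norm_sub_norm_le _ _).trans ?_
      rw [show y + x n + ∑ j ∈ Finset.range n, r j s • x j -
        (y - x n + ∑ j ∈ Finset.range n, r j s • x j) = (2 : ℝ) • x n by rw [two_smul]; abel,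
        norm_smul]
      simp
    set a := ∫ s, ‖y + x n + ∑ j ∈ Finset.range n, r j s • x j‖ ∂Q
    set b := ∫ s, ‖y - x n + ∑ j ∈ Finset.range n, r j s • x j‖ ∂Q
    set d := c ^ 2 / 2 * ∑ j ∈ Finset.range n, ‖x j‖ ^ 2 with hd
    have hsq : (a - b) ^ 2 ≤ (2 * ‖x n‖) ^ 2 := sq_le_sq' (by linarith [(abs_le.mp hab).1])
      (abs_le.mp hab).2
    calc _ ≤ (Real.exp (c * a + d) + Real.exp (c * b + d)) / 2 := by linarith
      _ = Real.exp (c * ((a + b) / 2) + d) * Real.cosh (c * (a - b) / 2) := by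
        rw [Real.cosh_eq, mul_div_assoc', mul_add, ← Real.exp_add, ← Real.exp_add]
        ring_nf
      _ ≤ Real.exp (c * ((a + b) / 2) + d) * Real.exp ((c * (a - b) / 2) ^ 2 / 2) := by
        gcongr
        exact Real.cosh_le_exp_half_sq _
      _ ≤ _ := by
        rw [← Real.exp_add, Real.exp_le_exp]
        have := mul_le_mul_of_nonneg_left hsq (sq_nonneg c)
        rw [mul_add, ← hd]
        nlinarith [this]

end IsRademacherFamily

/-! ### The type inequality for `L^q` moments -/

theorem exists_rpow_le_mul_exp (q : ℝ) (hq : 0 ≤ q) :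
    ∃ K : ℝ, 1 ≤ K ∧ ∀ t : ℝ, 0 ≤ t → t ^ q ≤ K * Real.exp t := by
  obtain ⟨n, hn⟩ := exists_nat_ge q
  refine ⟨1 + n.factorial, by simp, fun t ht => ?_⟩
  have h1 : t ^ n ≤ n.factorial * Real.exp t := by
    have := Real.pow_div_factorial_le_exp t ht n
    rwa [div_le_iff₀ (by positivity), mul_comm] at this
  have h2 : 1 ≤ Real.exp t := Real.one_le_exp ht
  rcases le_total t 1 with h | h
  · have : t ^ q ≤ 1 := Real.rpow_le_one ht h hq
    have : 0 ≤ (n.factorial : ℝ) * Real.exp t := by positivity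
    linarith
  · have : t ^ q ≤ t ^ (n : ℝ) := Real.rpow_le_rpow_of_exponent_le h hn
    rw [Real.rpow_natCast] at this
    linarith

/-- If `r ≤ 2`, the `ℓ²` norm is at most the `ℓ^r` norm. -/
theorem sum_sq_le_rpow_sum_rpow {ι : Type*} (s : Finset ι) (a : ι → ℝ) (ha : ∀ i, 0 ≤ a i)
    {r : ℝ} (hr : 1 ≤ r) (hr2 : r ≤ 2) :
    ∑ i ∈ s, a i ^ 2 ≤ ((∑ i ∈ s, a i ^ r) ^ (1 / r)) ^ 2 := by
  have hr0 : 0 < r := by linarith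
  set T := ∑ i ∈ s, a i ^ r with hT
  have hT0 : 0 ≤ T := Finset.sum_nonneg fun i _ => Real.rpow_nonneg (ha i) _
  have hle : ∀ i ∈ s, a i ≤ T ^ (1 / r) := by
    intro i hi
    have h : a i ^ r ≤ T := Finset.single_le_sum (f := fun i => a i ^ r)
      (fun i _ => Real.rpow_nonneg (ha i) _) hi
    calc a i = (a i ^ r) ^ (1 / r) := by
          rw [← Real.rpow_mul (ha i), mul_one_div_cancel hr0.ne', Real.rpow_one]
      _ ≤ _ := by gcongr; exact Real.rpow_nonneg (ha i) _
  have hsplit : ∀ t : ℝ, 0 ≤ t → t ^ 2 = t ^ r * t ^ (2 - r) := by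
    intro t ht
    rw [← Real.rpow_add_of_nonneg ht hr0.le (by linarith), add_sub_cancel, Real.rpow_two]
  have hTr : (T ^ (1 / r)) ^ r = T := by
    rw [← Real.rpow_mul hT0, one_div_mul_cancel hr0.ne', Real.rpow_one]
  rw [hsplit _ (Real.rpow_nonneg hT0 _), hTr]
  calc ∑ i ∈ s, a i ^ 2 ≤ ∑ i ∈ s, a i ^ r * (T ^ (1 / r)) ^ (2 - r) := by
        refine Finset.sum_le_sum fun i hi => ?_
        rw [hsplit _ (ha i)]
        exact mul_le_mul_of_nonneg_left
          (Real.rpow_le_rpow (ha i) (hle i hi) (by linarith)) (Real.rpow_nonneg (ha i) _)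
    _ = _ := by rw [← Finset.sum_mul]

/-- Test the inequality on a single nonzero vector. The bound lets additive constants be absorbed
into `τ`. -/
theorem HasTypeConstant.one_le {V : Type*} [NormedAddCommGroup V] [NormedSpace ℝ V] [Nontrivial V]
    {p τ : ℝ} (hp : 1 ≤ p) (hτ : HasTypeConstant V p τ) : 1 ≤ τ := by
  obtain ⟨S, _, Q, _, r, hr⟩ := exists_isRademacherFamily
  obtain ⟨x, hx⟩ := exists_ne (0 : V)
  have hx0 : 0 < ‖x‖ := norm_pos_iff.mpr hx
  have h := hτ S Q r hr 1 (fun _ => x)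
  have h1 : eLpNorm (fun s => ∑ j ∈ Finset.range 1, r j s • x) (ENNReal.ofReal p) Q =
      ENNReal.ofReal ‖x‖ := by
    rw [eLpNorm_congr_norm_ae (g := fun _ => x) (Filter.Eventually.of_forall fun s => by
      simp [norm_smul, hr.abs_eq_one]), eLpNorm_const _ (by simp; linarith)
      (IsProbabilityMeasure.ne_zero Q)]
    simp
  rw [h1, Finset.sum_range_one, ← Real.rpow_mul hx0.le, mul_one_div_cancel (by linarith),
    Real.rpow_one] at h
  by_contra hlt
  push Not at hlt
  have h2 : τ * ‖x‖ < ‖x‖ := by nlinarith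
  exact absurd h (not_le.mpr ((ENNReal.ofReal_lt_ofReal_iff hx0).mpr h2))

/-- In the defining inequality of type `r`, the `L^r` norm of the Rademacher sum may be replaced
by the `L^q` norm, at the cost of a factor depending on `q` only. -/
theorem exists_lintegral_enorm_rademacher_sum_le (q : ℝ) (hq : 1 ≤ q) :
    ∃ K : ℝ, 1 ≤ K ∧ ∀ (V : Type u) [NormedAddCommGroup V] [NormedSpace ℝ V] [Nontrivial V]
      (r τ : ℝ), 1 ≤ r → r ≤ 2 → HasTypeConstant V r τ →
      ∀ (S : Type) [MeasurableSpace S] (Q : Measure S) [IsProbabilityMeasure Q] (ρ : ℕ → S → ℝ),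
        IsRademacherFamily Q ρ → ∀ (n : ℕ) (x : ℕ → V),
        ∫⁻ s, ‖∑ j ∈ Finset.range n, ρ j s • x j‖ₑ ^ q ∂Q ≤
          ENNReal.ofReal ((K * τ) ^ q * (∑ j ∈ Finset.range n, ‖x j‖ ^ r) ^ (q / r)) := by
  obtain ⟨K, hK1, hK⟩ := exists_rpow_le_mul_exp q (by linarith)
  -- The `2` comes from `(τ + t) ^ q ≤ 2 ^ q * (τ ^ q + t ^ q)`; `3 * K` is `K` plus `K` times an
  -- exponential moment bounded by `2`.
  refine ⟨2 * (1 + 3 * K), by linarith, ?_⟩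
  intro V _ _ _ r τ hr hr2 hτ S _ Q _ ρ hρ n x
  have hq0 : 0 < q := by linarith
  have hr0 : 0 < r := by linarith
  have hτ1 := hτ.one_le hr
  set T := ∑ j ∈ Finset.range n, ‖x j‖ ^ r with hT
  have hT0 : 0 ≤ T := Finset.sum_nonneg fun i _ => Real.rpow_nonneg (norm_nonneg _) _
  rcases hT0.eq_or_lt with hT' | hTpos
  · have hx : ∀ j ∈ Finset.range n, x j = 0 := by
      intro j hj
      have := (Finset.sum_eq_zero_iff_of_nonneg
        (fun i _ => Real.rpow_nonneg (norm_nonneg (x i)) r)).mp hT'.symm j hj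
      rw [Real.rpow_eq_zero (norm_nonneg _) hr0.ne'] at this
      exact norm_eq_zero.mp this
    have : ∀ s, ∑ j ∈ Finset.range n, ρ j s • x j = 0 := fun s =>
      Finset.sum_eq_zero fun j hj => by rw [hx j hj, smul_zero]
    simp [this, ENNReal.zero_rpow_of_pos hq0]
  set σ := T ^ (1 / r) with hσ
  have hσ0 : 0 < σ := Real.rpow_pos_of_pos hTpos _
  have hσq : T ^ (q / r) = σ ^ q := by
    rw [hσ, ← Real.rpow_mul hT0]; congr 1; ring
  set Z : S → ℝ := fun s => ‖∑ j ∈ Finset.range n, ρ j s • x j‖ with hZ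
  have hZint : Integrable Z Q := by
    simpa using hρ.integrable_comp_sum (F := fun v : V => ‖v‖) (by fun_prop) n x 0
  have hEint : Integrable (fun s => Real.exp (1 / σ * Z s)) Q := by
    simpa using hρ.integrable_comp_sum (F := fun v : V => Real.exp (1 / σ * ‖v‖))
      (by fun_prop) n x 0
  have hZmeas : AEStronglyMeasurable (fun s => ∑ j ∈ Finset.range n, ρ j s • x j) Q := by
    have hρm : StronglyMeasurable fun s (j : Finset.range n) => ρ j s :=
      (measurable_pi_lambda _ fun j : Finset.range n => hρ.measurable j).stronglyMeasurable
    refine (Continuous.comp_stronglyMeasurable (g := fun z : Finset.range n → ℝ =>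
      ∑ j, z j • x j) (by fun_prop) hρm).aestronglyMeasurable.congr
        (Filter.Eventually.of_forall fun s => ?_)
    simp only
    rw [← Finset.sum_coe_sort (Finset.range n)]
  set m := ∫ s, Z s ∂Q with hm
  have hmle : m ≤ τ * σ := by
    have h1 := (eLpNorm_le_eLpNorm_of_exponent_le (p := 1) (q := ENNReal.ofReal r)
      (by simpa using hr) hZmeas).trans (hτ S Q ρ hρ n x)
    rw [eLpNorm_one_eq_lintegral_enorm, ← hT, ← hσ] at h1
    rw [hm, hZ, integral_norm_eq_lintegral_enorm hZmeas]
    exact ENNReal.toReal_le_of_le_ofReal (by positivity) h1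
  -- With exponent `1 / σ` the variance term is at most `1 / 2`, since `r ≤ 2` bounds the `ℓ²` norm
  -- by `σ`.
  have hexp : ∫ s, Real.exp (1 / σ * Z s) ∂Q ≤ Real.exp (m / σ) * 2 := by
    have h1 := hρ.integral_exp_norm_le (1 / σ) x n (0 : V)
    simp only [zero_add] at h1
    refine h1.trans ?_
    have h2 := sum_sq_le_rpow_sum_rpow (Finset.range n) (fun j => ‖x j‖)
      (fun j => norm_nonneg _) hr hr2
    rw [← hT, ← hσ] at h2
    have h3 : (1 / σ) ^ 2 / 2 * ∑ j ∈ Finset.range n, ‖x j‖ ^ 2 ≤ 1 / 2 := by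
      calc _ ≤ (1 / σ) ^ 2 / 2 * σ ^ 2 := by gcongr
        _ = 1 / 2 := by field_simp
    have h4 : Real.exp (1 / 2) ≤ 2 := by
      have h5 : Real.exp (1 / 2) ^ 2 = Real.exp 1 := by
        rw [← Real.exp_nat_mul]; norm_num
      nlinarith [Real.exp_one_lt_d9, Real.exp_pos (1 / 2 : ℝ)]
    rw [Real.exp_add]
    have h5 : 1 / σ * ∫ s, ‖∑ j ∈ Finset.range n, ρ j s • x j‖ ∂Q = m / σ := by
      rw [hm, hZ]; ring
    rw [h5]
    gcongr
    exact (Real.exp_le_exp.mpr h3).trans h4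
  have hpt : ∀ s, Z s ^ q ≤ σ ^ q * 2 ^ q *
      (τ ^ q + K + K * Real.exp (-(m / σ)) * Real.exp (1 / σ * Z s)) := by
    intro s
    have hZs : 0 ≤ Z s := norm_nonneg _
    -- Normalized excess over the mean, truncated at `0` so that `t ^ q ≤ K * exp t` applies.
    set t := max 0 ((Z s - m) / σ) with ht
    have ht0 : 0 ≤ t := le_max_left _ _
    have h1 : Z s ≤ σ * (τ + t) := by
      have : (Z s - m) / σ ≤ t := le_max_right _ _
      rw [div_le_iff₀ hσ0] at this
      nlinarith
    have h2 : (τ + t) ^ q ≤ 2 ^ q * (τ ^ q + t ^ q) := by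
      calc (τ + t) ^ q ≤ (2 * max τ t) ^ q := by
            gcongr
            linarith [le_max_left τ t, le_max_right τ t]
        _ = 2 ^ q * (max τ t) ^ q := Real.mul_rpow (by norm_num) (by positivity)
        _ ≤ _ := by
            gcongr
            rcases max_cases τ t with ⟨h, _⟩ | ⟨h, _⟩ <;> rw [h]
            · linarith [Real.rpow_nonneg ht0 q]
            · linarith [Real.rpow_nonneg (zero_le_one.trans hτ1) q]
    have h3 : Real.exp t ≤ 1 + Real.exp (-(m / σ)) * Real.exp (1 / σ * Z s) := by
      rw [← Real.exp_add, show -(m / σ) + 1 / σ * Z s = (Z s - m) / σ by ring]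
      rcases max_cases 0 ((Z s - m) / σ) with ⟨h, _⟩ | ⟨h, _⟩ <;> rw [ht, h]
      · simp [Real.exp_nonneg]
      · linarith
    calc Z s ^ q ≤ (σ * (τ + t)) ^ q := by gcongr
      _ = σ ^ q * (τ + t) ^ q := Real.mul_rpow hσ0.le (by positivity)
      _ ≤ σ ^ q * (2 ^ q * (τ ^ q + t ^ q)) := by gcongr
      _ ≤ σ ^ q * (2 ^ q * (τ ^ q +
          K * (1 + Real.exp (-(m / σ)) * Real.exp (1 / σ * Z s)))) := by
        gcongr
        exact (hK t ht0).trans (by gcongr)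
      _ = _ := by ring
  have hZq : Integrable (fun s => Z s ^ q) Q := by
    simpa using hρ.integrable_comp_sum (F := fun v : V => ‖v‖ ^ q)
      (continuous_norm.rpow_const fun _ => Or.inr hq0.le) n x 0
  have hreal : ∫ s, Z s ^ q ∂Q ≤ (2 * (1 + 3 * K) * τ) ^ q * σ ^ q := by
    have hτq : 1 ≤ τ ^ q := Real.one_le_rpow hτ1 hq0.le
    calc ∫ s, Z s ^ q ∂Q ≤ ∫ s, σ ^ q * 2 ^ q *
          (τ ^ q + K + K * Real.exp (-(m / σ)) * Real.exp (1 / σ * Z s)) ∂Q :=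
          integral_mono hZq (((integrable_const _).add (hEint.const_mul _)).const_mul _) hpt
      _ = σ ^ q * 2 ^ q * (τ ^ q + K + K * Real.exp (-(m / σ)) *
          ∫ s, Real.exp (1 / σ * Z s) ∂Q) := by
        rw [integral_const_mul, integral_add (integrable_const _) (hEint.const_mul _),
          integral_const_mul]
        simp
      _ ≤ σ ^ q * 2 ^ q * (τ ^ q + K + K * Real.exp (-(m / σ)) *
          (Real.exp (m / σ) * 2)) := by gcongr
      _ = σ ^ q * 2 ^ q * (τ ^ q + 3 * K) := by
        rw [Real.exp_neg]
        field_simp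
        ring
      _ ≤ σ ^ q * 2 ^ q * ((1 + 3 * K) * τ ^ q) := by
        gcongr
        nlinarith
      _ ≤ σ ^ q * 2 ^ q * ((1 + 3 * K) ^ q * τ ^ q) := by
        gcongr
        exact Real.self_le_rpow_of_one_le (by linarith) hq
      _ = _ := by
        rw [Real.mul_rpow (by linarith) (by linarith), Real.mul_rpow (by norm_num) (by linarith)]
        ring
  rw [hσq]
  refine le_trans (le_of_eq ?_) (ENNReal.ofReal_le_ofReal hreal)
  rw [ofReal_integral_eq_lintegral_ofReal hZq
    (Filter.Eventually.of_forall fun s => Real.rpow_nonneg (norm_nonneg _) _)]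
  refine lintegral_congr fun s => ?_
  rw [← ENNReal.ofReal_rpow_of_nonneg (norm_nonneg _) hq0.le, ofReal_norm]

/-! ### Symmetrization and sums of independent variables -/

/-- Adding an independent centred random variable does not decrease the `q`-th moment. -/
theorem ProbabilityTheory.IndepFun.lintegral_enorm_rpow_le_add {Ω V : Type*} [MeasurableSpace Ω]
    {P : Measure Ω} [IsProbabilityMeasure P] [NormedAddCommGroup V] [NormedSpace ℝ V]
    [CompleteSpace V] [MeasurableSpace V] [BorelSpace V] [SecondCountableTopology V]
    {U W : Ω → V} (hUW : IndepFun U W P) (hU : AEMeasurable U P) (hW : Integrable W P)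
    (hW0 : ∫ ω, W ω ∂P = 0) {q : ℝ} (hq : 1 ≤ q) :
    ∫⁻ ω, ‖U ω‖ₑ ^ q ∂P ≤ ∫⁻ ω, ‖U ω + W ω‖ₑ ^ q ∂P := by
  have hWm := hW.aemeasurable
  have : IsProbabilityMeasure (P.map W) := Measure.isProbabilityMeasure_map hWm
  have h1 : ∫⁻ ω, ‖U ω + W ω‖ₑ ^ q ∂P =
      ∫⁻ u, ∫⁻ w, ‖u + w‖ₑ ^ q ∂(P.map W) ∂(P.map U) := by
    rw [← lintegral_prod (fun z : V × V => ‖z.1 + z.2‖ₑ ^ q) (by fun_prop),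
      ← (indepFun_iff_map_prod_eq_prod_map_map hU hWm).mp hUW,
      lintegral_map' (by fun_prop) (hU.prodMk hWm)]
  have h2 : ∫⁻ ω, ‖U ω‖ₑ ^ q ∂P = ∫⁻ u, ‖u‖ₑ ^ q ∂(P.map U) := by
    rw [lintegral_map' (by fun_prop) hU]
  have hidI : Integrable (fun w : V => w) (P.map W) :=
    (integrable_map_measure aestronglyMeasurable_id hWm).mpr hW
  have hid0 : ∫ w, w ∂(P.map W) = 0 := by
    exact (integral_map hWm aestronglyMeasurable_id).trans hW0
  rw [h1, h2]
  refine lintegral_mono fun u => ?_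
  -- Jensen with `u` frozen: `u` is the mean of `u + W`.
  have h3 : ‖u‖ₑ ≤ ∫⁻ w, ‖u + w‖ₑ ∂(P.map W) := by
    calc ‖u‖ₑ = ‖∫ w, (u + w) ∂(P.map W)‖ₑ := by
          rw [integral_add (integrable_const _) hidI, hid0]; simp
      _ ≤ _ := enorm_integral_le_lintegral_enorm _
  have h4 := eLpNorm_le_eLpNorm_of_exponent_le (μ := P.map W) (f := fun w => u + w) (p := 1)
    (q := ENNReal.ofReal q) (by simpa using hq) (by fun_prop)
  rw [eLpNorm_one_eq_lintegral_enorm, eLpNorm_eq_lintegral_rpow_enorm_toReal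
    (by simp; linarith) (by simp), ENNReal.toReal_ofReal (by linarith)] at h4
  calc ‖u‖ₑ ^ q ≤ ((∫⁻ w, ‖u + w‖ₑ ^ q ∂(P.map W)) ^ (1 / q)) ^ q :=
        ENNReal.rpow_le_rpow (h3.trans h4) (by linarith)
    _ = _ := by rw [← ENNReal.rpow_mul, one_div_mul_cancel (by linarith), ENNReal.rpow_one]

theorem ProbabilityTheory.IndepFun.eLpNorm_le_add {Ω V : Type*} [MeasurableSpace Ω]
    {P : Measure Ω} [IsProbabilityMeasure P] [NormedAddCommGroup V] [NormedSpace ℝ V]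
    [CompleteSpace V] [MeasurableSpace V] [BorelSpace V] [SecondCountableTopology V]
    {U W : Ω → V} (hUW : IndepFun U W P) (hU : AEMeasurable U P) (hW : Integrable W P)
    (hW0 : ∫ ω, W ω ∂P = 0) {q : ℝ} (hq : 1 ≤ q) :
    eLpNorm U (ENNReal.ofReal q) P ≤ eLpNorm (fun ω => U ω + W ω) (ENNReal.ofReal q) P := by
  have hq0 : ENNReal.ofReal q ≠ 0 := by simp; linarith
  rw [eLpNorm_eq_lintegral_rpow_enorm_toReal hq0 (by simp),
    eLpNorm_eq_lintegral_rpow_enorm_toReal hq0 (by simp), ENNReal.toReal_ofReal (by linarith)]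
  exact ENNReal.rpow_le_rpow (hUW.lintegral_enorm_rpow_le_add hU hW hW0 hq) (by positivity)

/-- Changing signs of independent centred random variables changes the `L^q` norm of their sum
by at most a factor two. -/
theorem ProbabilityTheory.iIndepFun.eLpNorm_sum_le_two_mul_eLpNorm_sum_smul {Ω V : Type*}
    [MeasurableSpace Ω] {P : Measure Ω} [IsProbabilityMeasure P] [NormedAddCommGroup V]
    [NormedSpace ℝ V] [CompleteSpace V] [MeasurableSpace V] [BorelSpace V]
    [SecondCountableTopology V] {Y : ℕ → Ω → V} (hY : iIndepFun Y P)
    (hI : ∀ j, Integrable (Y j) P) (h0 : ∀ j, ∫ ω, Y j ω ∂P = 0) {q : ℝ} (hq : 1 ≤ q)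
    (n : ℕ) (s : ℕ → ℝ) (hs : ∀ j, s j = 1 ∨ s j = -1) :
    eLpNorm (fun ω => ∑ j ∈ Finset.range n, Y j ω) (ENNReal.ofReal q) P ≤
      2 * eLpNorm (fun ω => ∑ j ∈ Finset.range n, s j • Y j ω) (ENNReal.ofReal q) P := by
  classical
  -- Grouped by sign, the plain sum is `U + W` and the signed one `U - W`. Each of `U`, `W` is
  -- dominated by `U - W`, so no independent copies are needed.
  set A := (Finset.range n).filter (fun j => s j = 1)
  set B := (Finset.range n).filter (fun j => ¬ s j = 1)
  set U : Ω → V := fun ω => ∑ j ∈ A, Y j ω with hU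
  set W : Ω → V := fun ω => ∑ j ∈ B, Y j ω with hW
  have hsum : ∀ C : Finset ℕ, Integrable (fun ω => ∑ j ∈ C, Y j ω) P :=
    fun C => integrable_finsetSum _ fun j _ => hI j
  have hsum0 : ∀ C : Finset ℕ, ∫ ω, ∑ j ∈ C, Y j ω ∂P = 0 := fun C => by
    rw [integral_finsetSum _ fun j _ => hI j]
    exact Finset.sum_eq_zero fun j _ => h0 j
  have hind : IndepFun U W P := by
    have h := (hY.indepFun_finset₀ A B (Finset.disjoint_filter_filter_not _ _ _)
      fun j => (hI j).aemeasurable).comp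
      (φ := fun z : A → V => ∑ j, z j) (ψ := fun z : B → V => ∑ j, z j)
      (Continuous.measurable (by fun_prop)) (Continuous.measurable (by fun_prop))
    convert h using 1
    · funext ω
      simp only [hU, Function.comp_apply]
      rw [← Finset.sum_coe_sort A]
    · funext ω
      simp only [hW, Function.comp_apply]
      rw [← Finset.sum_coe_sort B]
  have hT : (fun ω => ∑ j ∈ Finset.range n, Y j ω) = U + W := by
    funext ω
    exact (Finset.sum_filter_add_sum_filter_not _ _ _).symm
  have hD : (fun ω => ∑ j ∈ Finset.range n, s j • Y j ω) = fun ω => U ω + -W ω := by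
    funext ω
    rw [← Finset.sum_filter_add_sum_filter_not (Finset.range n) (fun j => s j = 1)]
    congr 1
    · exact Finset.sum_congr rfl fun j hj => by rw [(Finset.mem_filter.mp hj).2, one_smul]
    · rw [hW, ← Finset.sum_neg_distrib]
      refine Finset.sum_congr rfl fun j hj => ?_
      rw [(hs j).resolve_left (Finset.mem_filter.mp hj).2, neg_one_smul]
  have h1 : eLpNorm U (ENNReal.ofReal q) P ≤
      eLpNorm (fun ω => U ω + -W ω) (ENNReal.ofReal q) P :=
    (hind.comp measurable_id measurable_neg).eLpNorm_le_add (hsum A).aemeasurable (hsum B).neg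
      (by
        have : ∫ ω, -W ω ∂P = 0 := by rw [integral_neg, hsum0, neg_zero]
        exact this) hq
  have h2 : eLpNorm W (ENNReal.ofReal q) P ≤
      eLpNorm (fun ω => U ω + -W ω) (ENNReal.ofReal q) P := by
    have h : eLpNorm W (ENNReal.ofReal q) P ≤
        eLpNorm (fun ω => W ω + -U ω) (ENNReal.ofReal q) P :=
      (hind.symm.comp measurable_id measurable_neg).eLpNorm_le_add (hsum B).aemeasurable
        (hsum A).neg
        (by
          have : ∫ ω, -U ω ∂P = 0 := by rw [integral_neg, hsum0, neg_zero]
          exact this) hq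
    refine h.trans (le_of_eq ?_)
    rw [← eLpNorm_neg]
    congr 1
    funext ω
    simp [add_comm]
  rw [hT, hD, two_mul]
  exact (eLpNorm_add_le (hsum A).aestronglyMeasurable (hsum B).aestronglyMeasurable
    (by simpa using hq)).trans (add_le_add h1 h2)

/-- `L^q` bound for sums of independent centred random variables in a space of type `r ≤ q`, with
a factor that is uniform in `r`. -/
theorem exists_eLpNorm_sum_le_of_hasTypeConstant (q : ℝ) (hq : 1 ≤ q) :
    ∃ K : ℝ, 1 ≤ K ∧ ∀ (V : Type u) [NormedAddCommGroup V] [NormedSpace ℝ V] [Nontrivial V]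
      [CompleteSpace V] [MeasurableSpace V] [BorelSpace V] [SecondCountableTopology V]
      (r τ : ℝ), 1 ≤ r → r ≤ 2 → r ≤ q → HasTypeConstant V r τ →
      ∀ (Ω : Type v) [MeasurableSpace Ω] (P : Measure Ω) [IsProbabilityMeasure P] (Y : ℕ → Ω → V)
        (b : ℝ), 0 ≤ b → iIndepFun Y P → (∀ j, Integrable (Y j) P) → (∀ j, ∫ ω, Y j ω ∂P = 0) →
        (∀ j, eLpNorm (Y j) (ENNReal.ofReal q) P ≤ ENNReal.ofReal b) → ∀ n : ℕ,
        eLpNorm (fun ω => ∑ j ∈ Finset.range n, Y j ω) (ENNReal.ofReal q) P ≤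
          ENNReal.ofReal (K * τ * (n : ℝ) ^ (1 / r) * b) := by
  obtain ⟨K, hK1, hK⟩ := exists_lintegral_enorm_rademacher_sum_le.{u} q hq
  refine ⟨2 * K, by linarith, ?_⟩
  intro V _ _ _ _ _ _ _ r τ hr hr2 hrq hτ Ω _ P _ Y b hb hY hI h0 hYb n
  obtain ⟨S, _, Q, _, ρ, hρ⟩ := exists_isRademacherFamily
  have hq0 : 0 < q := by linarith
  have hr0 : 0 < r := by linarith
  have hτ1 : 1 ≤ τ := hτ.one_le hr
  have hqr : 1 ≤ q / r := by rwa [one_le_div hr0]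
  have heL : ∀ f : Ω → V, eLpNorm f (ENNReal.ofReal q) P = (∫⁻ ω, ‖f ω‖ₑ ^ q ∂P) ^ (1 / q) := by
    intro f
    rw [eLpNorm_eq_lintegral_rpow_enorm_toReal (by simp; linarith) (by simp),
      ENNReal.toReal_ofReal hq0.le]
  have heLq : ∀ f : Ω → V, ∫⁻ ω, ‖f ω‖ₑ ^ q ∂P = eLpNorm f (ENNReal.ofReal q) P ^ q := by
    intro f
    rw [heL, ← ENNReal.rpow_mul, one_div_mul_cancel hq0.ne', ENNReal.rpow_one]
  have hpt : ∀ ω, ∫⁻ s, ‖∑ j ∈ Finset.range n, ρ j s • Y j ω‖ₑ ^ q ∂Q ≤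
      ENNReal.ofReal ((K * τ) ^ q * (n : ℝ) ^ (q / r - 1)) *
        ∑ j ∈ Finset.range n, ‖Y j ω‖ₑ ^ q := by
    intro ω
    refine (hK V r τ hr hr2 hτ S Q ρ hρ n (fun j => Y j ω)).trans ?_
    -- Power mean inequality with exponent `q / r ≥ 1`; this is where `r ≤ q` enters.
    have h1 := Real.rpow_sum_le_const_mul_sum_rpow (Finset.range n) (fun j => ‖Y j ω‖ ^ r) hqr
    have h2 : ∀ j, |‖Y j ω‖ ^ r| = ‖Y j ω‖ ^ r := fun j =>
      abs_of_nonneg (Real.rpow_nonneg (norm_nonneg _) _)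
    have h3 : ∀ j, (‖Y j ω‖ ^ r) ^ (q / r) = ‖Y j ω‖ ^ q := fun j => by
      rw [← Real.rpow_mul (norm_nonneg _), mul_div_cancel₀ _ hr0.ne']
    simp only [h2, h3, Finset.card_range] at h1
    calc _ ≤ ENNReal.ofReal ((K * τ) ^ q * ((n : ℝ) ^ (q / r - 1) *
          ∑ j ∈ Finset.range n, ‖Y j ω‖ ^ q)) := by
          refine ENNReal.ofReal_le_ofReal ?_
          have : 0 ≤ (K * τ) ^ q := by positivity
          gcongr
      _ = _ := by
          rw [← mul_assoc, ENNReal.ofReal_mul (by positivity),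
            ENNReal.ofReal_sum_of_nonneg fun j _ => Real.rpow_nonneg (norm_nonneg _) _]
          congr 1
          refine Finset.sum_congr rfl fun j _ => ?_
          rw [← ENNReal.ofReal_rpow_of_nonneg (norm_nonneg _) hq0.le, ofReal_norm]
  have hmeas : AEMeasurable (fun z : S × Ω =>
      ‖∑ j ∈ Finset.range n, ρ j z.1 • Y j z.2‖ₑ ^ q) (Q.prod P) := by
    refine AEMeasurable.pow_const (AEMeasurable.enorm ?_) _
    refine Finset.aemeasurable_fun_sum _ fun j _ => ?_
    exact ((hρ.measurable j).comp measurable_fst).aemeasurable.smul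
      (hI j).aemeasurable.comp_snd
  have hmain : ∫⁻ ω, ‖∑ j ∈ Finset.range n, Y j ω‖ₑ ^ q ∂P ≤
      ENNReal.ofReal (2 * K * τ * (n : ℝ) ^ (1 / r) * b) ^ q := by
    -- The inequality for fixed signs is averaged over random signs; after Tonelli the type
    -- inequality applies for each fixed `ω`.
    calc ∫⁻ ω, ‖∑ j ∈ Finset.range n, Y j ω‖ₑ ^ q ∂P
        = ∫⁻ _ : S, ∫⁻ ω, ‖∑ j ∈ Finset.range n, Y j ω‖ₑ ^ q ∂P ∂Q := by simp
      _ ≤ ∫⁻ s, 2 ^ q * ∫⁻ ω, ‖∑ j ∈ Finset.range n, ρ j s • Y j ω‖ₑ ^ q ∂P ∂Q := by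
        refine lintegral_mono fun s => ?_
        simp only
        rw [heLq, heLq, ← ENNReal.mul_rpow_of_nonneg _ _ hq0.le]
        exact ENNReal.rpow_le_rpow (hY.eLpNorm_sum_le_two_mul_eLpNorm_sum_smul hI h0 hq n
          (fun j => ρ j s) fun j => hρ.values j s) hq0.le
      _ = 2 ^ q * ∫⁻ ω, ∫⁻ s, ‖∑ j ∈ Finset.range n, ρ j s • Y j ω‖ₑ ^ q ∂Q ∂P := by
        rw [lintegral_const_mul' _ _ (by simp), lintegral_lintegral_swap hmeas]
      _ ≤ 2 ^ q * ∫⁻ ω, ENNReal.ofReal ((K * τ) ^ q * (n : ℝ) ^ (q / r - 1)) *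
          ∑ j ∈ Finset.range n, ‖Y j ω‖ₑ ^ q ∂P := by
        gcongr with ω
        exact hpt ω
      _ = 2 ^ q * (ENNReal.ofReal ((K * τ) ^ q * (n : ℝ) ^ (q / r - 1)) *
          ∑ j ∈ Finset.range n, ∫⁻ ω, ‖Y j ω‖ₑ ^ q ∂P) := by
        rw [lintegral_const_mul' _ _ (by simp), lintegral_finsetSum' _ fun j _ =>
          (hI j).aemeasurable.enorm.pow_const _]
      _ ≤ 2 ^ q * (ENNReal.ofReal ((K * τ) ^ q * (n : ℝ) ^ (q / r - 1)) *
          ∑ j ∈ Finset.range n, ENNReal.ofReal (b ^ q)) := by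
        gcongr with j _
        rw [heLq, ← ENNReal.ofReal_rpow_of_nonneg hb hq0.le]
        exact ENNReal.rpow_le_rpow (hYb j) hq0.le
      _ = ENNReal.ofReal (2 ^ q * ((K * τ) ^ q * (n : ℝ) ^ (q / r - 1) * (n * b ^ q))) := by
        rw [Finset.sum_const, Finset.card_range, nsmul_eq_mul, ← ENNReal.ofReal_natCast,
          ← ENNReal.ofReal_mul (by positivity), ← ENNReal.ofReal_mul (by positivity),
          ENNReal.ofReal_mul (by positivity) (p := 2 ^ q),
          ← ENNReal.ofReal_rpow_of_nonneg zero_le_two hq0.le, ENNReal.ofReal_ofNat]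
      _ = _ := by
        rw [ENNReal.ofReal_rpow_of_nonneg (by positivity) hq0.le]
        congr 1
        have hexpand : (2 * K * τ * (n : ℝ) ^ (1 / r) * b) ^ q =
            2 ^ q * (K * τ) ^ q * (n : ℝ) ^ (q / r) * b ^ q := by
          rw [Real.mul_rpow (by positivity) hb, Real.mul_rpow (by positivity) (by positivity),
            mul_assoc 2 K τ, Real.mul_rpow (x := 2) (by positivity) (by positivity),
            ← Real.rpow_mul (by positivity), one_div_mul_eq_div]
        have hn : (n : ℝ) ^ (q / r - 1) * n = (n : ℝ) ^ (q / r) := by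
          rcases Nat.eq_zero_or_pos n with rfl | hn
          · rw [Nat.cast_zero, mul_zero, Real.zero_rpow (by positivity)]
          · rw [Real.rpow_sub_one (by positivity), div_mul_cancel₀ _ (by positivity)]
        rw [hexpand, ← hn]
        ring
  rw [heL]
  calc _ ≤ (ENNReal.ofReal (2 * K * τ * (n : ℝ) ^ (1 / r) * b) ^ q) ^ (1 / q) :=
        ENNReal.rpow_le_rpow hmain (by positivity)
    _ = _ := by rw [← ENNReal.rpow_mul, mul_one_div_cancel hq0.ne', ENNReal.rpow_one]

/-! ### Error of the Monte Carlo estimator -/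

/-- Bias-variance type bound for the single-level Monte Carlo estimator. -/
theorem exists_slmcError_le (q : ℝ) (hq : 1 ≤ q) :
    ∃ K : ℝ, 1 ≤ K ∧ ∀ (E : Type u) [NormedAddCommGroup E] [NormedSpace ℝ E] [CompleteSpace E]
      [MeasurableSpace E] [BorelSpace E] (Ω : Type v) [MeasurableSpace Ω] (P : Measure Ω)
      [IsProbabilityMeasure P] (X : Ω → E) (V : Submodule ℝ E) [FiniteDimensional ℝ V]
      [Nontrivial V] (r τ : ℝ), 1 ≤ r → r ≤ 2 → r ≤ q → HasTypeConstant V r τ →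
      ∀ (Z : Ω → V), MemLp Z (ENNReal.ofReal q) P → ∀ (Y : ℕ → Ω → V), iIndepFun Y P →
      (∀ j, IdentDistrib (Y j) Z P P) → ∀ (b : ℝ), 0 ≤ b →
      eLpNorm (fun ω => (Z ω : E) - ∫ ω', (Z ω' : E) ∂P) (ENNReal.ofReal q) P ≤
        ENNReal.ofReal b → ∀ M : ℕ, 1 ≤ M →
      slmcError P q X (fun j ω => (Y j ω : E)) M ≤
        ENNReal.ofReal (‖(∫ ω, X ω ∂P) - ∫ ω, (Z ω : E) ∂P‖ + K * τ * (M : ℝ) ^ (1 / r - 1) * b) := by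
  obtain ⟨K, hK1, hK⟩ := exists_eLpNorm_sum_le_of_hasTypeConstant.{u, v} q hq
  refine ⟨K, hK1, ?_⟩
  intro E _ _ _ _ _ Ω _ P _ X V _ _ r τ hr hr2 hrq hτ Z hZ Y hY hid b hb hZb M hM
  -- Supplies completeness and second countability of `V`; `E` itself need not be separable.
  have : ProperSpace V := FiniteDimensional.proper_real V
  have hq1 : 1 ≤ ENNReal.ofReal q := by simpa using hq
  have hτ1 : 1 ≤ τ := hτ.one_le hr
  have hM0 : (0 : ℝ) < M := by exact_mod_cast hM
  have hZI : Integrable Z P := hZ.integrable hq1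
  set m : V := ∫ ω, Z ω ∂P with hm
  have hmE : ∫ ω, (Z ω : E) ∂P = (m : E) := V.subtypeL.integral_comp_comm hZI
  rw [hmE] at hZb ⊢
  have hsubm : Measurable fun v : V => v - m := by fun_prop
  have hidm : ∀ j, IdentDistrib (fun ω => Y j ω - m) (fun ω => Z ω - m) P P :=
    fun j => (hid j).comp hsubm
  have hYI : ∀ j, Integrable (Y j) P := fun j => (hid j).integrable_iff.mpr hZI
  have hYm0 : ∀ j, ∫ ω, (Y j ω - m) ∂P = 0 := by
    intro j
    rw [integral_sub (hYI j) (integrable_const _), (hid j).integral_eq, ← hm]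
    simp
  have hYb : ∀ j, eLpNorm (fun ω => Y j ω - m) (ENNReal.ofReal q) P ≤ ENNReal.ofReal b := by
    intro j
    rw [(hidm j).eLpNorm_eq]
    exact hZb
  have hsum := hK V r τ hr hr2 hrq hτ Ω P (fun j ω => Y j ω - m) b hb
    (hY.comp (fun _ v => v - m) fun _ => hsubm) (fun j => (hYI j).sub (integrable_const _))
    hYm0 hYb M
  have hdec : (fun ω => (∫ ω', X ω' ∂P) - (1 / (M : ℝ)) • ∑ j ∈ Finset.range M, (Y j ω : E)) =
      (fun _ => (∫ ω', X ω' ∂P) - (m : E)) -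
        (1 / (M : ℝ)) • fun ω => ((∑ j ∈ Finset.range M, (Y j ω - m) : V) : E) := by
    funext ω
    simp only [Pi.sub_apply, Pi.smul_apply, Submodule.coe_sum, Submodule.coe_sub,
      Finset.sum_sub_distrib, Finset.sum_const, Finset.card_range, smul_sub]
    rw [← Nat.cast_smul_eq_nsmul ℝ M m, Submodule.coe_smul, smul_smul, one_div_mul_cancel hM0.ne', one_smul]
    abel
  have hmeasS : AEStronglyMeasurable
      (fun ω => ((∑ j ∈ Finset.range M, (Y j ω - m) : V) : E)) P :=
    V.subtypeL.continuous.comp_aestronglyMeasurable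
      (integrable_finsetSum _ fun j _ => (hYI j).sub (integrable_const m)).aestronglyMeasurable
  unfold slmcError
  rw [hdec]
  refine (eLpNorm_sub_le aestronglyMeasurable_const (hmeasS.const_smul _) hq1).trans ?_
  rw [ENNReal.ofReal_add (norm_nonneg _) (by positivity)]
  refine add_le_add ?_ ?_
  · rw [eLpNorm_const _ (by positivity) (IsProbabilityMeasure.ne_zero P)]
    simp [ofReal_norm]
  · rw [eLpNorm_const_smul]
    calc _ ≤ ENNReal.ofReal (1 / M) * ENNReal.ofReal (K * τ * (M : ℝ) ^ (1 / r) * b) := by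
          refine mul_le_mul' (le_of_eq ?_) hsum
          rw [← ofReal_norm, Real.norm_of_nonneg (by positivity)]
      _ = _ := by
          rw [← ENNReal.ofReal_mul (by positivity), Real.rpow_sub_one hM0.ne']
          congr 1
          ring

/-! ### Choice of level and sample size, and the cost -/

/-- The factor `2` gives strict room above the infimum, so some admissible `τ` lies below the bound.
-/
theorem exists_hasTypeConstant_le_of_typeConstant_rpow_le {V : Type*} [NormedAddCommGroup V]
    [NormedSpace ℝ V] {r s G : ℝ} (hs : 0 < s) (hG : 0 < G)
    (h : typeConstant V r ^ s ≤ ENNReal.ofReal G) :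
    ∃ τ : ℝ, HasTypeConstant V r τ ∧ τ ≤ 2 * G ^ (1 / s) := by
  have hG' : 0 < G ^ (1 / s) := Real.rpow_pos_of_pos hG _
  have h1 : typeConstant V r ≤ ENNReal.ofReal (G ^ (1 / s)) := by
    rw [← ENNReal.ofReal_rpow_of_nonneg hG.le (by positivity)]
    calc typeConstant V r = (typeConstant V r ^ s) ^ (1 / s) := by
          rw [← ENNReal.rpow_mul, mul_one_div_cancel hs.ne', ENNReal.rpow_one]
      _ ≤ _ := ENNReal.rpow_le_rpow h (by positivity)
  have h2 : typeConstant V r < ENNReal.ofReal (2 * G ^ (1 / s)) :=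
    h1.trans_lt ((ENNReal.ofReal_lt_ofReal_iff (by positivity)).mpr (by linarith))
  obtain ⟨_, ⟨τ, ⟨_, hτ⟩, rfl⟩, hlt⟩ := sInf_lt_iff.mp h2
  exact ⟨τ, hτ, ((ENNReal.ofReal_lt_ofReal_iff (by positivity)).mp hlt).le⟩

theorem exists_pnat_pow_mem {A : ℝ} (hA : 1 < A) {x : ℝ} (hx : 1 ≤ x) :
    ∃ L : ℕ+, x ≤ A ^ (L : ℕ) ∧ A ^ (L : ℕ) ≤ A * x := by
  obtain ⟨n, h1, h2⟩ := exists_nat_pow_near hx hA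
  refine ⟨n.succPNat, h2.le, ?_⟩
  rw [Nat.succPNat_coe, Nat.succ_eq_add_one, pow_succ, mul_comm]
  gcongr

/-- Sample size times unit cost on a level of dimension `N ≍ ε ^ (-1 / α)`. -/
theorem sampleSize_mul_rpow_le {ε α γ a₀ a₁ s B Cτ D D' N : ℝ} (hε : 0 < ε) (hα : 0 < α)
    (hγ : 0 < γ) (ha₀ : 0 ≤ a₀) (ha₁ : 0 ≤ a₁) (hs : 0 ≤ s) (hB : 0 ≤ B) (hCτ : 0 ≤ Cτ)
    (hD : 0 < D) (hDN : D * ε ^ (-(1 / α)) ≤ N) (hND : N ≤ D' * ε ^ (-(1 / α))) :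
    (B / ε) ^ s * (Cτ * N ^ (a₀ - a₁ * s)) * N ^ γ ≤
      Cτ * D' ^ (a₀ + γ) * (B * D ^ (-a₁)) ^ s * ε ^ (-s - (γ + a₀ - a₁ * s) / α) := by
  have he : 0 < ε ^ (-(1 / α)) := Real.rpow_pos_of_pos hε _
  have hDe : 0 < D * ε ^ (-(1 / α)) := by positivity
  have hN : 0 < N := hDe.trans_le hDN
  have hD' : 0 < D' := by
    by_contra h
    push Not at h
    nlinarith [mul_nonpos_of_nonpos_of_nonneg h he.le]
  -- Collecting the powers `s` separates `N ^ (a₀ + γ)`, bounded by the upper estimate for `N`, from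
  -- `N ^ (-a₁)`, bounded by the lower one. The sign of `a₀ - a₁ * s` is thus irrelevant.
  have h1 : (B / ε) ^ s * (Cτ * N ^ (a₀ - a₁ * s)) * N ^ γ =
      Cτ * N ^ (a₀ + γ) * (B / ε * N ^ (-a₁)) ^ s := by
    rw [Real.mul_rpow (by positivity) (by positivity), ← Real.rpow_mul hN.le,
      show a₀ - a₁ * s = a₀ + -a₁ * s by ring, Real.rpow_add hN, Real.rpow_add hN]
    ring
  have h2 : N ^ (-a₁) ≤ (D * ε ^ (-(1 / α))) ^ (-a₁) :=
    Real.rpow_le_rpow_of_nonpos hDe hDN (by linarith)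
  have h3 : B / ε * (D * ε ^ (-(1 / α))) ^ (-a₁) = B * D ^ (-a₁) * ε ^ (a₁ / α - 1) := by
    rw [Real.mul_rpow hD.le he.le, ← Real.rpow_mul hε.le, Real.rpow_sub_one hε.ne',
      show -(1 / α) * -a₁ = a₁ / α by ring]
    ring
  rw [h1]
  calc Cτ * N ^ (a₀ + γ) * (B / ε * N ^ (-a₁)) ^ s
      ≤ Cτ * (D' * ε ^ (-(1 / α))) ^ (a₀ + γ) *
        (B / ε * (D * ε ^ (-(1 / α))) ^ (-a₁)) ^ s := by gcongr
    _ = Cτ * D' ^ (a₀ + γ) * (B * D ^ (-a₁)) ^ s *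
        (ε ^ (-(1 / α) * (a₀ + γ)) * ε ^ ((a₁ / α - 1) * s)) := by
      rw [h3, Real.mul_rpow hD'.le he.le, Real.mul_rpow (by positivity) (by positivity),
        ← Real.rpow_mul hε.le, ← Real.rpow_mul hε.le]
      ring
    _ = _ := by
      rw [← Real.rpow_add hε]
      congr 2
      field_simp
      ring

theorem mainTheorem4
    (q α γ a₀ a₁ Cα Cstab Cτ Cγ A c₁ c₂ : ℝ)
    (hq : 1 < q) (hα : 0 < α) (hγ : 0 < γ) (ha₀ : 0 ≤ a₀) (ha₁ : 0 ≤ a₁)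
    (hCα : 0 < Cα) (hCstab : 0 < Cstab) (hCτ : 1 ≤ Cτ) (hCγ : 0 < Cγ)
    (hA : 1 < A) (hc₁ : 0 < c₁) (hc₂ : 0 < c₂) :
    ∃ C : ℝ, 0 < C ∧
      ∀ (p : ℝ), p ∈ Set.Icc (1 : ℝ) 2 → p ≤ q →
      ∀ (E : Type u) [NormedAddCommGroup E] [NormedSpace ℝ E] [CompleteSpace E]
        [MeasurableSpace E] [BorelSpace E],
      IsOfRademacherType E p →
      ∀ (Ω : Type v) [MeasurableSpace Ω] (P : Measure Ω) [IsProbabilityMeasure P]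
        (X : Ω → E), MemLp X 1 P →
      ∀ (V : ℕ+ → Submodule ℝ E), (∀ ℓ, FiniteDimensional ℝ (V ℓ)) →
      TypeConstantGrowth V p a₀ a₁ Cτ →
      ∀ (Xl : ∀ ℓ : ℕ+, Ω → V ℓ), (∀ ℓ, MemLp (Xl ℓ) (ENNReal.ofReal q) P) →
      ∀ (Xs : ∀ ℓ : ℕ+, ℕ → Ω → V ℓ),
      (∀ ℓ, iIndepFun (Xs ℓ) P) →
      (∀ ℓ j, IdentDistrib (Xs ℓ j) (Xl ℓ) P P) →
      (∀ ℓ, (Module.finrank ℝ (V ℓ) : ℝ) ^ α *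
        ‖(∫ ω, X ω ∂P) - ∫ ω, (Xl ℓ ω : E) ∂P‖ ≤ Cα) →
      (∀ ℓ, eLpNorm (fun ω => (Xl ℓ ω : E) - ∫ ω', (Xl ℓ ω' : E) ∂P) (ENNReal.ofReal q) P ≤
        ENNReal.ofReal Cstab) →
      (∀ ℓ : ℕ+, c₁ * A ^ (ℓ : ℕ) ≤ Module.finrank ℝ (V ℓ) ∧
        Module.finrank ℝ (V ℓ) ≤ c₂ * A ^ (ℓ : ℕ)) →
      ∀ (cost : ℕ+ → ℝ),
      (∀ ℓ, 0 ≤ cost ℓ ∧ cost ℓ ≤ Cγ * (Module.finrank ℝ (V ℓ) : ℝ) ^ γ) →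
      ∀ ε ∈ Set.Ioc (0 : ℝ) (1 / 2),
        ∃ (L : ℕ+) (M : ℕ), 1 ≤ M ∧
          slmcError P q X (fun j ω => (Xs L j ω : E)) M < ENNReal.ofReal ε ∧
          (a₁ ≤ α → slmcCost cost L M ≤
            C * (ε ^ (-(γ / α)) +
              ε ^ (-(min q 2).conjExponent -
                (γ + a₀ - a₁ * (min q 2).conjExponent) / α))) ∧
          (α < a₁ → 1 < p → slmcCost cost L M ≤
            C * (ε ^ (-(γ / α)) +
              ε ^ (-p.conjExponent - (γ + a₀ - a₁ * p.conjExponent) / α))) := by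
  obtain ⟨K, hK1, hK⟩ := exists_slmcError_le.{u, v} q hq.le
  -- `8` is the `2` lost in choosing `τ` times the `4` in the target `ε / 4`.
  set B := 8 * K * Cstab with hB
  have hB0 : 0 < B := by positivity
  -- The first summand controls the bias, the second gives `B * D ^ (-a₁) ≤ 1`. For `a₁ = 0` the
  -- latter is the harmless value `B ^ 0 = 1`.
  set D := (4 * Cα) ^ (1 / α) + B ^ (1 / a₁) with hD
  have hD0 : 0 < D := by positivity
  have hDα : 4 * Cα ≤ D ^ α := by
    calc 4 * Cα = ((4 * Cα) ^ (1 / α)) ^ α := by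
          rw [← Real.rpow_mul (by positivity), one_div_mul_cancel hα.ne', Real.rpow_one]
      _ ≤ D ^ α := by
          gcongr
          exact le_add_of_nonneg_right (by positivity)
  have hDa₁ : 0 < a₁ → B * D ^ (-a₁) ≤ 1 := by
    intro ha
    have h : B ≤ D ^ a₁ := by
      calc B = (B ^ (1 / a₁)) ^ a₁ := by
            rw [← Real.rpow_mul (by positivity), one_div_mul_cancel ha.ne', Real.rpow_one]
        _ ≤ D ^ a₁ := by
            gcongr
            exact le_add_of_nonneg_left (by positivity)
    rw [Real.rpow_neg hD0.le]
    exact mul_inv_le_one_of_le₀ h (by positivity)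
  set D' := c₂ * (A * (D / c₁ + 1)) with hD'
  have hA0 : 0 < A := by linarith
  have hD'0 : 0 < D' := by positivity
  -- For `r = min q 2` this factor is independent of `p` and goes into `C`; for `r = p` the factor
  -- is at most `1`.
  set Θ := (B * D ^ (-a₁)) ^ (min q 2).conjExponent with hΘ
  have hΘ0 : 0 ≤ Θ := by positivity
  have hq' : 1 < min q 2 := lt_min hq one_lt_two
  refine ⟨Cγ * (D' ^ γ + Cτ * D' ^ (a₀ + γ) * (Θ + 1)), by positivity, ?_⟩
  intro p hp hpq E _ _ _ _ _ _ Ω _ P _ X _ V hV hgrowth Xl hXl Xs hind hid hbias hstab hdim cost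
    hcost ε hε
  have hε0 : 0 < ε := hε.1
  set e := ε ^ (-(1 / α)) with he
  have he1 : 1 ≤ e := Real.one_le_rpow_of_pos_of_le_one_of_nonpos hε0 (by linarith [hε.2])
    (by have : 0 < 1 / α := by positivity
        linarith)
  -- The `+ 1` keeps the target at least `1`, so that a positive level exists.
  obtain ⟨L, hL1, hL2⟩ := exists_pnat_pow_mem hA (x := (D / c₁ + 1) * e)
    (by nlinarith [div_pos hD0 hc₁])
  have hfin := hV L
  set N : ℝ := (Module.finrank ℝ (V L) : ℝ) with hN
  have hDN : D * e ≤ N := by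
    refine le_trans ?_ (hdim L).1
    calc D * e ≤ c₁ * ((D / c₁ + 1) * e) := by
          rw [show c₁ * ((D / c₁ + 1) * e) = D * e + c₁ * e by field_simp]
          exact le_add_of_nonneg_right (by positivity)
      _ ≤ _ := by gcongr
  have hND : N ≤ D' * e := by
    refine (hdim L).2.trans ?_
    calc c₂ * A ^ (L : ℕ) ≤ c₂ * (A * ((D / c₁ + 1) * e)) := by gcongr
      _ = D' * e := by rw [hD']; ring
  have hN0 : 0 < N := lt_of_lt_of_le (by positivity) hDN
  have hnt : Nontrivial (V L) := (Module.finrank_pos_iff (R := ℝ)).mp (Nat.cast_pos.mp hN0)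
  have hbiasε : ‖(∫ ω, X ω ∂P) - ∫ ω, (Xl L ω : E) ∂P‖ ≤ ε / 4 := by
    have h1 : 4 * Cα / ε ≤ N ^ α := by
      calc 4 * Cα / ε ≤ D ^ α / ε := by gcongr
        _ = (D * e) ^ α := by
          rw [Real.mul_rpow hD0.le (by positivity), he, ← Real.rpow_mul hε0.le,
            show -(1 / α) * α = -1 by field_simp, Real.rpow_neg_one, div_eq_mul_inv]
        _ ≤ N ^ α := by gcongr
    have h2 := (mul_le_mul_of_nonneg_right h1 (norm_nonneg
      ((∫ ω, X ω ∂P) - ∫ ω, (Xl L ω : E) ∂P))).trans (hbias L)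
    rw [div_mul_eq_mul_div, div_le_iff₀ hε0] at h2
    nlinarith
  have hNγ : N ^ γ ≤ D' ^ γ * ε ^ (-(γ / α)) := by
    calc N ^ γ ≤ (D' * e) ^ γ := by gcongr
      _ = _ := by
        rw [Real.mul_rpow hD'0.le (by positivity), he, ← Real.rpow_mul hε0.le]
        congr 2
        ring
  have main : ∀ r, 1 < r → r ≤ 2 → p ≤ r → r ≤ q → ∃ M : ℕ, 1 ≤ M ∧
      slmcError P q X (fun j ω => (Xs L j ω : E)) M < ENNReal.ofReal ε ∧
      slmcCost cost L M ≤ Cγ * (D' ^ γ * ε ^ (-(γ / α)) +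
        Cτ * D' ^ (a₀ + γ) * (B * D ^ (-a₁)) ^ r.conjExponent *
          ε ^ (-r.conjExponent - (γ + a₀ - a₁ * r.conjExponent) / α)) := by
    intro r hr hr2 hpr hrq
    have hconj := Real.HolderConjugate.conjExponent hr
    set s := r.conjExponent with hs
    have hs0 : 0 < s := hconj.symm.pos
    set G := Cτ * N ^ (a₀ - a₁ * s) with hG
    have hG0 : 0 < G := by positivity
    have htype : typeConstant (V L) r ^ s ≤ ENNReal.ofReal G := by
      have h := hgrowth L r ⟨⟨hpr, hr2⟩, hr, hr2⟩
      rw [← hN, ← hs, Real.rpow_neg hN0.le, ENNReal.ofReal_inv_of_pos (by positivity)] at h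
      rw [hG, mul_comm, ENNReal.ofReal_mul (by positivity)]
      exact (ENNReal.inv_mul_le_iff (by simp; positivity) (by simp)).mp h
    obtain ⟨τ, hτ, hτG⟩ := exists_hasTypeConstant_le_of_typeConstant_rpow_le hs0 hG0 htype
    have hMpos : 0 < (B / ε) ^ s * G := by positivity
    -- This `M` balances `τ * M ^ (-(1 / s))` against `ε`; rounding up costs one extra sample, the
    -- source of the term `ε ^ (-(γ / α))`.
    refine ⟨⌈(B / ε) ^ s * G⌉₊, Nat.ceil_pos.mpr hMpos, ?_, ?_⟩
    · set M := ⌈(B / ε) ^ s * G⌉₊ with hM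
      have hM1 : 1 ≤ M := Nat.ceil_pos.mpr hMpos
      have hM0 : (0 : ℝ) < M := by exact_mod_cast hM1
      refine (hK E Ω P X (V L) r τ hr.le hr2 hrq hτ (Xl L) (hXl L) (Xs L) (hind L) (hid L) Cstab
        hCstab.le (hstab L) M hM1).trans_lt ((ENNReal.ofReal_lt_ofReal_iff hε0).mpr ?_)
      have h1 : B / ε * G ^ (1 / s) ≤ (M : ℝ) ^ (1 / s) := by
        calc B / ε * G ^ (1 / s) = ((B / ε) ^ s * G) ^ (1 / s) := by
              rw [Real.mul_rpow (by positivity) hG0.le, ← Real.rpow_mul (by positivity),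
                mul_one_div_cancel hs0.ne', Real.rpow_one]
          _ ≤ _ := by
              gcongr
              exact Nat.le_ceil _
      have h2 : (1 / r - 1 : ℝ) = -(1 / s) := by
        have := hconj.inv_add_inv_eq_one
        rw [one_div, one_div]
        linarith
      have h3 : K * τ * (M : ℝ) ^ (1 / r - 1) * Cstab ≤ ε / 4 := by
        rw [h2, Real.rpow_neg hM0.le]
        have hMs : 0 < (M : ℝ) ^ (1 / s) := by positivity
        rw [show K * τ * ((M : ℝ) ^ (1 / s))⁻¹ * Cstab = K * Cstab * τ / (M : ℝ) ^ (1 / s) by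
          field_simp, div_le_iff₀ hMs]
        calc K * Cstab * τ ≤ K * Cstab * (2 * G ^ (1 / s)) := by gcongr
          _ = ε / 4 * (B / ε * G ^ (1 / s)) := by rw [hB]; field_simp; ring
          _ ≤ _ := by gcongr
      linarith
    · have h1 := sampleSize_mul_rpow_le (s := s) hε0 hα hγ ha₀ ha₁ hs0.le hB0.le
        (zero_le_one.trans hCτ) hD0 hDN hND
      have h2 : (⌈(B / ε) ^ s * G⌉₊ : ℝ) ≤ (B / ε) ^ s * G + 1 := (Nat.ceil_lt_add_one hMpos.le).le
      unfold slmcCost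
      calc (⌈(B / ε) ^ s * G⌉₊ : ℝ) * cost L ≤ ((B / ε) ^ s * G + 1) * (Cγ * N ^ γ) := by
            gcongr
            · exact (hcost L).1
            · exact (hcost L).2
        _ = Cγ * (N ^ γ + (B / ε) ^ s * G * N ^ γ) := by ring
        _ ≤ _ := by gcongr
  have hfinal : ∀ u w t : ℝ, 0 ≤ u → 0 ≤ w → 0 ≤ t → t ≤ Θ + 1 →
      Cγ * (D' ^ γ * u + Cτ * D' ^ (a₀ + γ) * t * w) ≤
        Cγ * (D' ^ γ + Cτ * D' ^ (a₀ + γ) * (Θ + 1)) * (u + w) := by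
    intro u w t hu hw ht hle
    have h1 : Cτ * D' ^ (a₀ + γ) * t * w ≤ Cτ * D' ^ (a₀ + γ) * (Θ + 1) * w := by gcongr
    have h2 : 0 ≤ D' ^ γ * w := by positivity
    have h3 : 0 ≤ Cτ * D' ^ (a₀ + γ) * (Θ + 1) * u := by positivity
    rw [mul_assoc Cγ]
    exact mul_le_mul_of_nonneg_left (by linarith) hCγ.le
  -- One pair `L`, `M` must serve both implications, so `r` is fixed by the regime. For `α < a₁` and
  -- `p = 1` no cost bound is claimed, and `r = min q 2` still gives the error bound.
  by_cases hcase : α < a₁ ∧ 1 < p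
  · obtain ⟨M, hM, herr, hc⟩ := main p hcase.2 hp.2 le_rfl hpq
    refine ⟨L, M, hM, herr, fun h => absurd hcase.1 (not_lt.mpr h), fun _ _ => hc.trans ?_⟩
    refine hfinal _ _ _ (by positivity) (by positivity) (by positivity) ?_
    have := Real.rpow_le_one (by positivity) (hDa₁ (hα.trans hcase.1))
      (Real.HolderConjugate.conjExponent hcase.2).symm.nonneg
    linarith
  · obtain ⟨M, hM, herr, hc⟩ := main (min q 2) hq' (min_le_right _ _) (le_min hpq hp.2)
      (min_le_left _ _)
    refine ⟨L, M, hM, herr, fun _ => hc.trans ?_, fun h h' => absurd ⟨h, h'⟩ hcase⟩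
    exact hfinal _ _ _ (by positivity) (by positivity) (by positivity) (by linarith)
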